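/- **Conventions.** Homomorphisms of profinite groups are continuous. A subset $S$ of a profinite group $F$ converges to $1$ if every open subgroup of $F$ contains all but finitely many elements of $S$; the rank of $F$ is the least cardinality of a set of topological generators of $F$ converging to $1$. A finite embedding problem for $F$ is a pair of epimorphisms $(\varphi\colon F\to G,\ \alpha\colon H\to G)$ with $G,H$ finite; it is split if $\alpha$ has a section that is a homomorphism, and nontrivial if $\alpha$ is not an isomorphism. A proper solution is an epimorphism $\psi\colon F\to H$ with $\alpha\circ\psi=\varphi$. A family of proper solutions $(\psi_i)_{i\in I}$ is independent if, with $K=\operatorname{Ker}\varphi$, one has $(K:\bigcap_{i\in J}\operatorname{Ker}\psi_i)=\prod_{i\in J}(K:\operatorname{Ker}\psi_i)$ for every finite $J\subseteq I$. A profinite group $F$ of infinite rank is *quasi-free* if there is an infinite cardinal $m$ such that every nontrivial finite split embedding problem for $F$ has exactly $m$ distinct proper solutions; it is *quasi-free of rank $m$* if in addition $\operatorname{rank}F=m$. It is *semi-free* if every nontrivial finite split embedding problem for $F$ has $\operatorname{rank}(F)$ independent proper solutions. For a profinite group $C$ and an infinite set $X$, let $\ast_X C$ be the free product of copies $C_x$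 ($x\in X$) of $C$ in the sense of Binz–Neukirch–Wenzel, that is, the completion of the abstract free product of the $C_x$ with respect to its normal subgroups $N$ of finite index such that $N\cap C_x$ is open in $C_x$ for all $x$ and $C_x\subseteq N$ for all but finitely many $x$. Equivalently, every family of homomorphisms $\psi_x\colon C_x\to A$ into a finite group $A$ with $\psi_x(C_x)=1$ for all but finitely many $x$ extends uniquely to a homomorphism $\ast_X C\to A$, and the restrictions to the $C_x$ of any homomorphism from $\ast_X C$ to a finite group form such a family. Let $G*H$ denote the free profinite product of two profinite groups, and let $\hat F_\omega$ be the free profinite group of countably infinite rank (free on a countably infinite set converging to $1$). **Proposition.** Let $X$ be a set of infinite cardinality $m$, let $C=\prod_{p}\mathbb{Z}/p\mathbb{Z}$ be the direct product over all primes $p$, and let $F=(\ast_X C)*\hat F_\omega$. Then: (a) $F$ is quasi-free of rank $m$: $F$ has rank $m$, and every nontrivial finite split embedding problem for $F$ has exactly $m$ proper solutions. (b) The finite split embedding problem $(F\to 1,\ \mathbb{Z}/4\mathbb{Z}\to 1)$ has at most countably many independent proper solutions: every independent set of proper solutions is countable. In particular, if $m>\aleph_0$, then $F$ is quasi-free but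 not semi-free. -/

import Mathlib

universe u v w

/-! ### Completions of an abstract group -/

/-- The normal subgroups of finite index of `P` that belong to `𝒩`. -/
structure FinIndexNormal (P : Type u) [Group P] (𝒩 : Set (Subgroup P)) where
  toSubgroup : Subgroup P
  normal : toSubgroup.Normal
  finiteIndex : toSubgroup.FiniteIndex
  mem : toSubgroup ∈ 𝒩

attribute [instance] FinIndexNormal.normal FinIndexNormal.finiteIndex

/-- The finite quotient `P ⧸ N`; it carries the discrete topology. -/
def FinIndexNormal.Quot {P : Type u} [Group P] {𝒩 : Set (Subgroup P)}
    (N : FinIndexNormal P 𝒩) : Type u :=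
  P ⧸ N.toSubgroup

instance FinIndexNormal.instGroupQuot {P : Type u} [Group P] {𝒩 : Set (Subgroup P)}
    (N : FinIndexNormal P 𝒩) : Group N.Quot :=
  inferInstanceAs (Group (P ⧸ N.toSubgroup))

instance FinIndexNormal.instFiniteQuot {P : Type u} [Group P] {𝒩 : Set (Subgroup P)}
    (N : FinIndexNormal P 𝒩) : Finite N.Quot :=
  inferInstanceAs (Finite (P ⧸ N.toSubgroup))

instance FinIndexNormal.instTopologicalSpaceQuot {P : Type u} [Group P] {𝒩 : Set (Subgroup P)}
    (N : FinIndexNormal P 𝒩) : TopologicalSpace N.Quot :=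
  ⊥

instance FinIndexNormal.instDiscreteTopologyQuot {P : Type u} [Group P] {𝒩 : Set (Subgroup P)}
    (N : FinIndexNormal P 𝒩) : DiscreteTopology N.Quot :=
  ⟨rfl⟩

/-- The diagonal homomorphism of `P` into the product of its quotients `P ⧸ N`, `N ∈ 𝒩`. -/
def toQuotProd (P : Type u) [Group P] (𝒩 : Set (Subgroup P)) :
    P →* ((N : FinIndexNormal P 𝒩) → N.Quot) :=
  MonoidHom.pi fun N => QuotientGroup.mk' N.toSubgroup

/-- The completion of `P` with respect to the finite quotients `P ⧸ N`, `N ∈ 𝒩`: the closure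
of the image of `P` in the (compact) product of these finite discrete groups. When `𝒩` is closed
under finite intersections this is the inverse limit of the groups `P ⧸ N`. -/
abbrev ProCompletion (P : Type u) [Group P] (𝒩 : Set (Subgroup P)) : Type u :=
  ((toQuotProd P 𝒩).range.topologicalClosure :
    Subgroup ((N : FinIndexNormal P 𝒩) → N.Quot))

instance ProCompletion.instCompactSpace (P : Type u) [Group P] (𝒩 : Set (Subgroup P)) :
    CompactSpace (ProCompletion P 𝒩) :=
  isCompact_iff_compactSpace.mp (Subgroup.isClosed_topologicalClosure _).isCompact

/-- The canonical homomorphism of `P` into its completion. -/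
def ProCompletion.of (P : Type u) [Group P] (𝒩 : Set (Subgroup P)) : P →* ProCompletion P 𝒩 :=
  (toQuotProd P 𝒩).codRestrict _ fun x =>
    Subgroup.le_topologicalClosure _ (MonoidHom.mem_range.mpr ⟨x, rfl⟩)

/-! ### Free products of profinite groups and free profinite groups -/

/-- The free profinite product of a family of profinite groups converging to `1`
(Binz–Neukirch–Wenzel): the completion of the abstract free product with respect to the normal
subgroups of finite index that meet every factor in an open subgroup and contain all but
finitely many of the factors. -/
abbrev FreeProfiniteProduct {ι : Type u} (G : ι → Type v) [∀ i, Group (G i)]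
    [∀ i, TopologicalSpace (G i)] : Type (max u v) :=
  ProCompletion (Monoid.CoprodI G)
    {N | (∀ i, IsOpen ((N.comap (Monoid.CoprodI.of (M := G) (i := i)) : Subgroup (G i)) :
            Set (G i))) ∧
      {i | ¬ (Monoid.CoprodI.of (M := G) (i := i)).range ≤ N}.Finite}

/-- The free profinite product of two profinite groups: the completion of the abstract free
product with respect to the normal subgroups of finite index that meet both factors in open
subgroups. -/
abbrev FreeProfiniteProd₂ (G : Type u) (H : Type v) [Group G] [TopologicalSpace G]
    [Group H] [TopologicalSpace H] : Type (max u v) :=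
  ProCompletion (Monoid.Coprod G H)
    {N | IsOpen ((N.comap (Monoid.Coprod.inl : G →* Monoid.Coprod G H) : Subgroup G) : Set G) ∧
      IsOpen ((N.comap (Monoid.Coprod.inr : H →* Monoid.Coprod G H) : Subgroup H) : Set H)}

/-- The free profinite group on a set `S` converging to `1`: the completion of the
abstract free group on `S` with respect to the normal subgroups of finite index that contain all
but finitely many elements of `S`. -/
abbrev FreeProfiniteGroup (S : Type u) : Type u :=
  ProCompletion (FreeGroup S) {N | {s | FreeGroup.of s ∉ N}.Finite}

/-! ### Rank -/

/-- `S` generates the topological group `F` topologically. -/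
def GeneratesTopologically (F : Type u) [Group F] [TopologicalSpace F] [IsTopologicalGroup F]
    (S : Set F) : Prop :=
  (Subgroup.closure S).topologicalClosure = ⊤

/-- `S` converges to `1`: every open subgroup contains all but finitely many elements of `S`. -/
def ConvergesToOne (F : Type u) [Group F] [TopologicalSpace F] (S : Set F) : Prop :=
  ∀ U : Subgroup F, IsOpen (U : Set F) → (S \ (U : Set F)).Finite

/-- The rank of a profinite group: the least cardinality of a set of topological
generators converging to `1`. -/
noncomputable def profiniteRank (F : Type u) [Group F] [TopologicalSpace F]
    [IsTopologicalGroup F] : Cardinal.{u} :=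
  sInf {c | ∃ S : Set F, GeneratesTopologically F S ∧ ConvergesToOne F S ∧ Cardinal.mk S = c}

/-! ### Embedding problems -/

/-- A finite embedding problem `(φ : F → G, α : H → G)` for `F`: the groups `G`, `H` are finite
(and discrete), and `φ`, `α` are epimorphisms. Up to isomorphism every finite group lives in
the universe `Type`. -/
structure FiniteEmbeddingProblem (F : Type u) [Group F] [TopologicalSpace F] where
  G : Type
  H : Type
  [groupG : Group G]
  [finiteG : Finite G]
  [topG : TopologicalSpace G]
  [discreteG : DiscreteTopology G]
  [groupH : Group H]
  [finiteH : Finite H]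
  [topH : TopologicalSpace H]
  [discreteH : DiscreteTopology H]
  φ : F →ₜ* G
  φ_surjective : Function.Surjective φ
  α : H →ₜ* G
  α_surjective : Function.Surjective α

namespace FiniteEmbeddingProblem

attribute [instance] groupG finiteG topG discreteG groupH finiteH topH discreteH

/-- The embedding problem is split: `α` has a section that is a homomorphism. -/
def IsSplit {F : Type u} [Group F] [TopologicalSpace F] (E : FiniteEmbeddingProblem F) : Prop :=
  ∃ β : E.G →* E.H, ∀ g, E.α (β g) = g

/-- The embedding problem is nontrivial: `α` is not an isomorphism. -/
def IsNontrivial {F : Type u} [Group F] [TopologicalSpace F] (E : FiniteEmbeddingProblem F) :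
    Prop :=
  ¬ Function.Bijective E.α

/-- The set of proper solutions: continuous epimorphisms `ψ : F → H` with `α ∘ ψ = φ`. -/
def properSolutions {F : Type u} [Group F] [TopologicalSpace F] (E : FiniteEmbeddingProblem F) :
    Set (F →ₜ* E.H) :=
  {ψ | (∀ x, E.α (ψ x) = E.φ x) ∧ Function.Surjective ψ}

end FiniteEmbeddingProblem

/-- A family of open subgroups `M i` of a profinite group `K` is `K`-independent if
`(K : ⋂_{i ∈ s} M i) = ∏_{i ∈ s} (K : M i)` for every finite subfamily `s`. -/
def IndependentSubgroups {K : Type u} [Group K] {ι : Type v} (M : ι → Subgroup K) : Prop :=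
  ∀ s : Finset ι, (⨅ i ∈ s, M i).index = ∏ i ∈ s, (M i).index

/-- A set `Ψ` of solutions of `E` is independent if the family of the kernels
`Ker ψ ≤ Ker φ`, `ψ ∈ Ψ`, is `Ker φ`-independent. -/
def FiniteEmbeddingProblem.IndependentSolutions {F : Type u} [Group F] [TopologicalSpace F]
    (E : FiniteEmbeddingProblem F) (Ψ : Set (F →ₜ* E.H)) : Prop :=
  IndependentSubgroups fun ψ : Ψ =>
    (ψ.1.toMonoidHom.ker.subgroupOf E.φ.toMonoidHom.ker : Subgroup E.φ.toMonoidHom.ker)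

/-! ### Quasi-free and semi-free profinite groups -/

/-- Every nontrivial finite split embedding problem for `F` has exactly `m` distinct proper
solutions. -/
def HasExactlyProperSolutions (F : Type u) [Group F] [TopologicalSpace F] (m : Cardinal.{u}) :
    Prop :=
  ∀ E : FiniteEmbeddingProblem F, E.IsSplit → E.IsNontrivial →
    Cardinal.mk E.properSolutions = m

/-- A profinite group of infinite rank is quasi-free if there is an infinite cardinal `m` such
that every nontrivial finite split embedding problem has exactly `m` proper solutions. -/
def IsQuasiFree (F : Type u) [Group F] [TopologicalSpace F] [IsTopologicalGroup F]
    [CompactSpace F] [TotallyDisconnectedSpace F] : Prop :=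
  Cardinal.aleph0 ≤ profiniteRank F ∧
    ∃ m : Cardinal.{u}, Cardinal.aleph0 ≤ m ∧ HasExactlyProperSolutions F m

/-- A profinite group of infinite rank is semi-free if every nontrivial finite split embedding
problem has `rank F` independent proper solutions. -/
def IsSemiFree (F : Type u) [Group F] [TopologicalSpace F] [IsTopologicalGroup F]
    [CompactSpace F] [TotallyDisconnectedSpace F] : Prop :=
  Cardinal.aleph0 ≤ profiniteRank F ∧
    ∀ E : FiniteEmbeddingProblem F, E.IsSplit → E.IsNontrivial →
      ∃ Ψ : Set (F →ₜ* E.H), Ψ ⊆ E.properSolutions ∧ E.IndependentSolutions Ψ ∧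
        Cardinal.mk Ψ = profiniteRank F

/-! ### The example -/

/-- The profinite group `C = ∏_p ℤ/p`, with the product of the discrete topologies. -/
abbrev PrimeCyclicProduct : Type :=
  (p : Nat.Primes) → Multiplicative (ZMod p)

/-- The group `F`: the free profinite product of the free profinite product of copies of `C`
indexed by `X` with the free profinite group of countable rank. -/
abbrev ExampleGroup (X : Type u) : Type u :=
  FreeProfiniteProd₂ (FreeProfiniteProduct fun _ : X => PrimeCyclicProduct)
    (FreeProfiniteGroup ℕ)

/-- The embedding problem `(F → 1, ℤ/4 → 1)`. -/
def zmodFourProblem (F : Type u) [Group F] [TopologicalSpace F] : FiniteEmbeddingProblem F where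
  G := Unit
  H := Multiplicative (ZMod 4)
  φ := 1
  φ_surjective := fun y => ⟨1, Subsingleton.elim _ y⟩
  α := 1
  α_surjective := fun y => ⟨1, Subsingleton.elim _ y⟩

/-! ### Properties of completions -/

/-! A homomorphism from `F` to a finite group is the same as a choice of values on the copies of `C`
and on the free generators, nontrivial on only finitely many of them. The argument uses only this
universal property, recorded in `FreeProductData`.

Given a split problem with section `β` and kernel `K ≠ 1`, start from `ρ = β ∘ φ`. Reassigning `|K|`
free generators killed by `ρ` to the elements of `K` makes the solution proper. Further, `C` maps
onto a subgroup of prime order in `K`, and each of the `m` copies killed by `ρ` can separately be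
given this map; this yields `m` proper solutions (`mk_le_mk_properSolutions`). Conversely, a
homomorphism is determined by finitely many nontrivial values on a generating set converging to `1`,
which bounds the number of homomorphisms by the size of that set (`mk_hom_le`). The two bounds
together give both the rank and the exact count.

For `ℤ/4`, every homomorphism from `C` has image killed by squaring, so the square of `f : F → ℤ/4`
depends only on the values of `f` on the countably many free generators (`sq_eq_sq`). Two
independent proper solutions map `F` jointly onto `ℤ/4 × ℤ/4` and so have different squares. Hence
an independent set injects into the finitely supported functions `ℕ → ℤ/4`, a countable set. -/

theorem MonoidHom.continuous_of_isOpen_ker {G : Type u} {H : Type v} [Group G]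
    [TopologicalSpace G] [IsTopologicalGroup G] [Group H] [TopologicalSpace H]
    [DiscreteTopology H] (f : G →* H) (hf : IsOpen (f.ker : Set G)) : Continuous f := by
  refine continuous_of_continuousAt_one f ?_
  rw [ContinuousAt, map_one, nhds_discrete H, Filter.tendsto_pure]
  exact hf.mem_nhds (one_mem f.ker)

namespace ProCompletion

variable {P : Type u} [Group P] {𝒩 : Set (Subgroup P)}

theorem denseRange_of (P : Type u) [Group P] (𝒩 : Set (Subgroup P)) :
    DenseRange (of P 𝒩) := by
  rw [DenseRange, Topology.IsInducing.subtypeVal.dense_iff]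
  intro x
  have hx : (x : (N : FinIndexNormal P 𝒩) → N.Quot) ∈ closure (Set.range (toQuotProd P 𝒩)) := x.2
  rwa [← Set.range_comp]

theorem eq_top_of_isClosed {T : Subgroup (ProCompletion P 𝒩)}
    (hT : IsClosed (T : Set (ProCompletion P 𝒩))) (h : ∀ x, of P 𝒩 x ∈ T) : T = ⊤ := by
  refine (Subgroup.eq_top_iff' T).2 fun x => ?_
  exact closure_minimal (Set.range_subset_iff.2 h) hT (denseRange_of P 𝒩 x)

theorem continuous_of_comp {A : Type v} [Group A] [TopologicalSpace A] [IsTopologicalGroup A]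
    (g : A →* P) (hg : ∀ N ∈ 𝒩, IsOpen ((N.comap g : Subgroup A) : Set A)) :
    Continuous ((of P 𝒩).comp g) := by
  refine Continuous.subtype_mk (continuous_pi fun N => ?_) _
  refine MonoidHom.continuous_of_isOpen_ker
    (H := N.Quot) ((QuotientGroup.mk' N.toSubgroup).comp g) ?_
  have : ((QuotientGroup.mk' N.toSubgroup).comp g).ker = N.toSubgroup.comap g := by
    rw [← MonoidHom.comap_ker, QuotientGroup.ker_mk']
  exact this ▸ hg _ N.mem

/-- A basic neighbourhood of `1` in the product constrains finitely many coordinates, so the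
preimage of `U` contains a finite intersection of members of `𝒩`. The filter-like hypotheses on `𝒩`
then apply. -/
theorem comap_of_mem (htop : ⊤ ∈ 𝒩) (hinf : ∀ M ∈ 𝒩, ∀ N ∈ 𝒩, M ⊓ N ∈ 𝒩)
    (hup : ∀ M ∈ 𝒩, ∀ N, M ≤ N → N ∈ 𝒩) (U : Subgroup (ProCompletion P 𝒩))
    (hU : IsOpen (U : Set (ProCompletion P 𝒩))) : U.comap (of P 𝒩) ∈ 𝒩 := by
  have h1 : (U : Set (ProCompletion P 𝒩)) ∈ nhds 1 := hU.mem_nhds (one_mem U)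
  rw [nhds_subtype, Filter.mem_comap] at h1
  obtain ⟨V, hV, hVU⟩ := h1
  rw [nhds_pi, Filter.mem_pi] at hV
  obtain ⟨I, hI, t, ht, htV⟩ := hV
  have key : (⨅ N ∈ I, N.toSubgroup) ∈ 𝒩 := by
    clear htV
    induction I, hI using Set.Finite.induction_on with
    | empty => simpa using htop
    | @insert a s _ _ ih =>
      rw [iInf_insert]
      exact hinf _ a.mem _ ih
  refine hup _ key _ fun x hx => ?_
  refine hVU (htV fun N hN => ?_)
  have hxN : x ∈ N.toSubgroup := by
    simp only [Subgroup.mem_iInf] at hx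
    exact hx N hN
  have : (of P 𝒩 x).1 N = 1 := (QuotientGroup.eq_one_iff x).2 hxN
  rw [this]
  exact mem_of_mem_nhds (ht N)

/-- The kernel of `f` is itself one of the indices, so the extension is the projection to that
coordinate followed by the embedding of `P ⧸ ker f` into `H`. -/
theorem exists_lift {H : Type v} [Group H] [Finite H] [TopologicalSpace H] [DiscreteTopology H]
    (f : P →* H) (hf : f.ker ∈ 𝒩) :
    ∃ ψ : ProCompletion P 𝒩 →ₜ* H, ∀ x, ψ (of P 𝒩 x) = f x := by
  let N : FinIndexNormal P 𝒩 := ⟨f.ker, inferInstance, inferInstance, hf⟩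
  let q : N.Quot →* H := QuotientGroup.kerLift f
  exact ⟨⟨(q.comp (Pi.evalMonoidHom _ N)).comp (Subgroup.subtype _),
    (continuous_of_discreteTopology (f := q)).comp
      ((continuous_apply N).comp continuous_subtype_val)⟩, fun x => rfl⟩

end ProCompletion

/-! ### The three kinds of completions -/

namespace FreeProfiniteProduct

variable {ι : Type u} {G : ι → Type v} [∀ i, Group (G i)] [∀ i, TopologicalSpace (G i)]
  [∀ i, IsTopologicalGroup (G i)]

/-- The canonical homomorphism of a factor into the free profinite product. -/
def incl (G : ι → Type v) [∀ i, Group (G i)] [∀ i, TopologicalSpace (G i)]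
    [∀ i, IsTopologicalGroup (G i)] (i : ι) : G i →ₜ* FreeProfiniteProduct G :=
  ⟨(ProCompletion.of _ _).comp Monoid.CoprodI.of,
    ProCompletion.continuous_of_comp _ fun _ hN => hN.1 i⟩

theorem eq_top_of_isClosed {T : Subgroup (FreeProfiniteProduct G)}
    (hT : IsClosed (T : Set (FreeProfiniteProduct G))) (h : ∀ i g, incl G i g ∈ T) : T = ⊤ := by
  refine ProCompletion.eq_top_of_isClosed hT fun x => ?_
  induction x using Monoid.CoprodI.induction_on with
  | one => rw [map_one]; exact one_mem T
  | of i g => exact h i g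
  | mul x y hx hy => rw [map_mul]; exact mul_mem hx hy

theorem finite_setOf_exists_notMem {U : Subgroup (FreeProfiniteProduct G)}
    (hU : IsOpen (U : Set (FreeProfiniteProduct G))) : {i | ∃ g, incl G i g ∉ U}.Finite := by
  have := ProCompletion.comap_of_mem ?_ ?_ ?_ U hU
  · refine this.2.subset ?_
    rintro i ⟨g, hg⟩ hi
    exact hg (hi ⟨g, rfl⟩)
  · exact ⟨fun i => by simp, by simp⟩
  · rintro M ⟨hM, hM'⟩ N ⟨hN, hN'⟩
    refine ⟨fun i => (hM i).inter (hN i), (hM'.union hN').subset fun i hi => ?_⟩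
    by_contra hc
    simp only [Set.mem_union, Set.mem_ofPred_eq, not_or, not_not] at hc
    exact hi (le_inf hc.1 hc.2)
  · rintro M ⟨hM, hM'⟩ N hMN
    exact ⟨fun i => Subgroup.isOpen_mono (Subgroup.comap_mono hMN) (hM i),
      hM'.subset fun i hi hc => hi (hc.trans hMN)⟩

theorem exists_lift {H : Type w} [Group H] [Finite H] [TopologicalSpace H] [DiscreteTopology H]
    (f : ∀ i, G i →ₜ* H) (hf : {i | ∃ g, f i g ≠ 1}.Finite) :
    ∃ ψ : FreeProfiniteProduct G →ₜ* H, ∀ i g, ψ (incl G i g) = f i g := by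
  have hlift : ∀ i g, Monoid.CoprodI.lift (fun i => (f i).toMonoidHom)
      (Monoid.CoprodI.of (i := i) g) = f i g := fun i g => Monoid.CoprodI.lift_of _ _
  refine (ProCompletion.exists_lift (Monoid.CoprodI.lift fun i => (f i).toMonoidHom) ?_).imp
    fun ψ hψ i g => (hψ _).trans (hlift i g)
  · refine ⟨fun i => ?_, hf.subset fun i hi => ?_⟩
    · have : IsOpen ((f i) ⁻¹' {1}) := (isOpen_discrete _).preimage (f i).continuous_toFun
      convert this using 1
      ext g
      simp only [Subgroup.coe_comap, Set.mem_preimage, SetLike.mem_coe, MonoidHom.mem_ker, hlift,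
        Set.mem_singleton_iff]
    · by_contra hc
      simp only [Set.mem_ofPred_eq, not_exists, not_not] at hc
      refine hi ?_
      rintro _ ⟨g, rfl⟩
      rw [MonoidHom.mem_ker, hlift, hc g]

end FreeProfiniteProduct

namespace FreeProfiniteProd₂

variable {A : Type u} {B : Type v} [Group A] [TopologicalSpace A] [IsTopologicalGroup A]
  [Group B] [TopologicalSpace B] [IsTopologicalGroup B]

/-- The canonical homomorphism of the first factor into the free profinite product. -/
def inl (A : Type u) (B : Type v) [Group A] [TopologicalSpace A] [IsTopologicalGroup A]
    [Group B] [TopologicalSpace B] : A →ₜ* FreeProfiniteProd₂ A B :=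
  ⟨(ProCompletion.of _ _).comp Monoid.Coprod.inl,
    ProCompletion.continuous_of_comp _ fun _ hN => hN.1⟩

/-- The canonical homomorphism of the second factor into the free profinite product. -/
def inr (A : Type u) (B : Type v) [Group A] [TopologicalSpace A]
    [Group B] [TopologicalSpace B] [IsTopologicalGroup B] : B →ₜ* FreeProfiniteProd₂ A B :=
  ⟨(ProCompletion.of _ _).comp Monoid.Coprod.inr,
    ProCompletion.continuous_of_comp _ fun _ hN => hN.2⟩

theorem eq_top_of_isClosed {T : Subgroup (FreeProfiniteProd₂ A B)}
    (hT : IsClosed (T : Set (FreeProfiniteProd₂ A B))) (hl : ∀ a, inl A B a ∈ T)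
    (hr : ∀ b, inr A B b ∈ T) : T = ⊤ := by
  refine ProCompletion.eq_top_of_isClosed hT fun x => ?_
  induction x using Monoid.Coprod.induction_on with
  | inl a => exact hl a
  | inr b => exact hr b
  | mul x y hx hy => rw [map_mul]; exact mul_mem hx hy

theorem exists_lift {H : Type w} [Group H] [Finite H] [TopologicalSpace H] [DiscreteTopology H]
    (f : A →ₜ* H) (g : B →ₜ* H) :
    ∃ ψ : FreeProfiniteProd₂ A B →ₜ* H, (∀ a, ψ (inl A B a) = f a) ∧
      ∀ b, ψ (inr A B b) = g b := by
  refine (ProCompletion.exists_lift (Monoid.Coprod.lift f.toMonoidHom g.toMonoidHom) ?_).imp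
    fun ψ hψ => ⟨fun a => (hψ _).trans (Monoid.Coprod.lift_apply_inl _ _ _),
      fun b => (hψ _).trans (Monoid.Coprod.lift_apply_inr _ _ _)⟩
  · constructor
    · rw [MonoidHom.comap_ker, Monoid.Coprod.lift_comp_inl]
      exact (isOpen_discrete {1}).preimage f.continuous_toFun
    · rw [MonoidHom.comap_ker, Monoid.Coprod.lift_comp_inr]
      exact (isOpen_discrete {1}).preimage g.continuous_toFun

end FreeProfiniteProd₂

namespace FreeProfiniteGroup

variable {S : Type u}

/-- The canonical generators of the free profinite group. -/
def of (s : S) : FreeProfiniteGroup S :=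
  ProCompletion.of _ _ (FreeGroup.of s)

theorem eq_top_of_isClosed {T : Subgroup (FreeProfiniteGroup S)}
    (hT : IsClosed (T : Set (FreeProfiniteGroup S))) (h : ∀ s, of s ∈ T) : T = ⊤ := by
  refine ProCompletion.eq_top_of_isClosed hT fun x => ?_
  induction x using FreeGroup.induction_on with
  | C1 => rw [map_one]; exact one_mem T
  | of s => exact h s
  | inv_of s hs => rw [map_inv]; exact inv_mem hs
  | mul x y hx hy => rw [map_mul]; exact mul_mem hx hy

theorem finite_setOf_notMem {U : Subgroup (FreeProfiniteGroup S)}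
    (hU : IsOpen (U : Set (FreeProfiniteGroup S))) : {s | of s ∉ U}.Finite := by
  refine ProCompletion.comap_of_mem ?_ ?_ ?_ U hU
  · simp
  · intro M hM N hN
    refine (hM.union hN).subset fun s hs => ?_
    by_contra hc
    simp only [Set.mem_union, Set.mem_ofPred_eq, not_or, not_not] at hc
    exact hs hc
  · exact fun M hM N hMN => hM.subset fun s hs hc => hs (hMN hc)

theorem exists_lift {H : Type w} [Group H] [Finite H] [TopologicalSpace H] [DiscreteTopology H]
    (f : S → H) (hf : {s | f s ≠ 1}.Finite) :
    ∃ ψ : FreeProfiniteGroup S →ₜ* H, ∀ s, ψ (of s) = f s := by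
  refine (ProCompletion.exists_lift (FreeGroup.lift f) ?_).imp
    fun ψ hψ s => (hψ _).trans (FreeGroup.lift_apply_of ..)
  · simpa [MonoidHom.mem_ker] using hf

end FreeProfiniteGroup

/-! ### Counting homomorphisms -/

section Count

variable {F : Type u} [Group F] [TopologicalSpace F] [IsTopologicalGroup F]
  {H : Type} [Group H] [TopologicalSpace H] [DiscreteTopology H] {S : Set F}

theorem GeneratesTopologically.hom_ext (hS : GeneratesTopologically F S) {f g : F →ₜ* H}
    (h : ∀ s ∈ S, f s = g s) : f = g := by
  have hcl : IsClosed ((f.toMonoidHom.eqLocus g.toMonoidHom : Subgroup F) : Set F) :=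
    isClosed_eq f.continuous_toFun g.continuous_toFun
  have : (Subgroup.closure S).topologicalClosure ≤ f.toMonoidHom.eqLocus g.toMonoidHom :=
    Subgroup.topologicalClosure_minimal _ ((Subgroup.closure_le _).2 h) hcl
  rw [hS] at this
  exact ContinuousMonoidHom.ext fun x => this (Subgroup.mem_top x)

theorem GeneratesTopologically.finite_hom [Finite H] (hS : GeneratesTopologically F S)
    (hfin : S.Finite) : Finite (F →ₜ* H) := by
  have := hfin.to_subtype
  refine Finite.of_injective (fun (f : F →ₜ* H) (s : S) => f s) fun f g hfg => ?_
  exact hS.hom_ext fun s hs => congrFun hfg ⟨s, hs⟩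

/-- Encode `f` by the part of its graph over `S` with nontrivial values. Convergence to `1` makes it
finite, and an infinite `S × H` has only `|S|` finite subsets. -/
theorem GeneratesTopologically.mk_hom_le [Finite H] (hS : GeneratesTopologically F S)
    (hconv : ConvergesToOne F S) (hinf : S.Infinite) :
    Cardinal.mk (F →ₜ* H) ≤ Cardinal.mk S := by
  classical
  have := hinf.to_subtype
  have hfin (f : F →ₜ* H) : {a : S × H | f a.1 = a.2 ∧ a.2 ≠ 1}.Finite := by
    have h1 : (S \ (f.toMonoidHom.ker : Set F)).Finite :=
      hconv _ ((isOpen_discrete {1}).preimage f.continuous_toFun)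
    have h2 : {s : S | f s ≠ 1}.Finite :=
      Set.Finite.of_finite_image (h1.subset (by rintro _ ⟨s, hs, rfl⟩; exact ⟨s.2, hs⟩))
        Subtype.val_injective.injOn
    refine (h2.prod Set.finite_univ).subset ?_
    rintro ⟨s, y⟩ ⟨h, hy⟩
    exact ⟨fun h' => hy (h.symm.trans h'), trivial⟩
  have hinj : Function.Injective fun f : F →ₜ* H => (hfin f).toFinset := by
    intro f g hfg
    refine hS.hom_ext fun s hs => ?_
    -- Equal encodings agree on all nontrivial values; the value `1` is recovered as the absence of
    -- any other.
    have key (y : H) (hy : y ≠ 1) : f s = y ↔ g s = y := by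
      have := congrArg (fun t => ((⟨s, hs⟩, y) : S × H) ∈ t) hfg
      simpa [hy] using this
    by_cases hf : f s = 1
    · by_cases hg : g s = 1
      · rw [hf, hg]
      · exact (key _ hg).2 rfl
    · exact ((key _ hf).1 rfl).symm
  calc Cardinal.mk (F →ₜ* H) ≤ Cardinal.mk (Finset (S × H)) := Cardinal.mk_le_of_injective hinj
    _ = Cardinal.mk (S × H) := Cardinal.mk_finset_of_infinite _
    _ ≤ Cardinal.mk S := by
      rw [Cardinal.mk_prod]
      refine (Cardinal.mul_le_max_of_aleph0_le_left (by simp)).trans ?_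
      simp only [Cardinal.lift_uzero, max_le_iff, le_refl, true_and]
      refine le_trans ?_ (Cardinal.aleph0_le_mk S)
      simp

end Count

/-! ### The group `∏_p ℤ/p` -/

namespace PrimeCyclicProduct

/-- The element of `∏_p ℤ/p` all of whose components are `1`. -/
def generator : PrimeCyclicProduct := fun _ => Multiplicative.ofAdd 1

/-- This is the Chinese remainder theorem for the primes in `I`. -/
theorem exists_pow_generator (I : Finset Nat.Primes) (x : PrimeCyclicProduct) :
    ∃ k : ℕ, ∀ p ∈ I, (generator ^ k) p = x p := by
  obtain ⟨k, hk⟩ := Nat.chineseRemainderOfFinset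
    (fun p : Nat.Primes => (Multiplicative.toAdd (x p)).val) (fun p => (p : ℕ)) I
    (fun p _ => p.2.ne_zero)
    (fun p _ q _ hpq => (Nat.coprime_primes p.2 q.2).2 fun h => hpq (Subtype.ext h))
  refine ⟨k, fun p hp => ?_⟩
  have hpk := (ZMod.natCast_eq_natCast_iff _ _ _).2 (hk p hp)
  have : NeZero (p : ℕ) := ⟨p.2.ne_zero⟩
  rw [ZMod.natCast_zmod_val] at hpk
  change Multiplicative.ofAdd (1 : ZMod p) ^ k = x p
  rw [← ofAdd_nsmul, nsmul_one, hpk, ofAdd_toAdd]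

/-- `C` is procyclic: neighbourhoods see only finitely many coordinates, where powers of `generator`
attain everything. -/
theorem closure_generator : (Subgroup.closure {generator}).topologicalClosure = ⊤ := by
  refine (Subgroup.eq_top_iff' _).2 fun x => ?_
  refine mem_closure_iff_nhds.2 fun t ht => ?_
  rw [nhds_pi, Filter.mem_pi] at ht
  obtain ⟨I, hI, s, hs, hst⟩ := ht
  obtain ⟨k, hk⟩ := exists_pow_generator hI.toFinset x
  refine ⟨generator ^ k, hst fun p hp => ?_,
    pow_mem (Subgroup.subset_closure (Set.mem_singleton generator)) k⟩
  rw [hk p (hI.mem_toFinset.2 hp)]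
  exact mem_of_mem_nhds (hs p)

/-- At `p = 2` squares vanish, and at odd `p` one can divide by `2`. Consequently squares in `C` die
in any group of exponent `4`. -/
theorem exists_sq_eq_pow_four (g : PrimeCyclicProduct) :
    ∃ h : PrimeCyclicProduct, g ^ 2 = h ^ 4 := by
  have key (p : Nat.Primes) : ∃ b : ZMod p, 2 * Multiplicative.toAdd (g p) = 4 * b := by
    by_cases hp : (p : ℕ) = 2
    · have h2 : (2 : ZMod p) = 0 := by
        have := ZMod.natCast_self (p : ℕ)
        rw [hp] at this ⊢
        exact this
      exact ⟨0, by rw [h2]; simp⟩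
    · have : Fact (p : ℕ).Prime := ⟨p.2⟩
      have h2 : (2 : ZMod p) ≠ 0 := by
        have := (ZMod.natCast_eq_zero_iff 2 (p : ℕ)).not.2
          fun h => hp ((Nat.prime_dvd_prime_iff_eq p.2 Nat.prime_two).1 h)
        exact_mod_cast this
      refine ⟨Multiplicative.toAdd (g p) / 2, ?_⟩
      field_simp
      ring
  choose b hb using key
  refine ⟨fun p => Multiplicative.ofAdd (b p), funext fun p => Multiplicative.toAdd.injective ?_⟩
  have := hb p
  simpa [Pi.pow_apply, toAdd_pow, nsmul_eq_mul] using this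

/-- Project to the `p`-th factor and identify it with the cyclic group generated by `k`. -/
theorem exists_hom {K : Type v} [Group K] [TopologicalSpace K] {k : K} (p : Nat.Primes)
    (hk : orderOf k = p) :
    ∃ f : PrimeCyclicProduct →ₜ* K, (∀ c, f c ∈ Subgroup.zpowers k) ∧ ∃ c, f c = k := by
  let f : ZMod p →+ Additive K := ZMod.lift p ⟨zmultiplesHom (Additive K) (Additive.ofMul k), by
    rw [zmultiplesHom_apply, natCast_zsmul, ← ofMul_pow, ← hk, pow_orderOf_eq_one, ofMul_one]⟩
  let f' : Multiplicative (ZMod p) →* K := AddMonoidHom.toMultiplicativeLeft f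
  have hf (z : ℤ) : f' (Multiplicative.ofAdd (z : ZMod p)) = k ^ z := by
    change Additive.toMul (f (z : ZMod p)) = k ^ z
    simp only [f, ZMod.lift_coe]
    rfl
  refine ⟨⟨f'.comp (Pi.evalMonoidHom _ p),
    (continuous_of_discreteTopology (f := f')).comp (continuous_apply p)⟩, fun c => ?_,
    Pi.mulSingle p (Multiplicative.ofAdd 1), ?_⟩
  · obtain ⟨z, hz⟩ := ZMod.intCast_surjective (Multiplicative.toAdd (c p))
    refine ⟨z, ?_⟩
    change k ^ z = f' (c p)
    rw [← hf, hz, ofAdd_toAdd]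
  · change f' ((Pi.mulSingle p (Multiplicative.ofAdd 1) : PrimeCyclicProduct) p) = k
    rw [Pi.mulSingle_eq_same]
    simpa using hf 1

end PrimeCyclicProduct

/-! ### The problem `ℤ/4 → 1` and independence of two solutions -/

theorem zmodFourProblem_isSplit (F : Type u) [Group F] [TopologicalSpace F] :
    (zmodFourProblem F).IsSplit :=
  ⟨(1 : Unit →* Multiplicative (ZMod 4)), fun _ => rfl⟩

theorem zmodFourProblem_isNontrivial (F : Type u) [Group F] [TopologicalSpace F] :
    (zmodFourProblem F).IsNontrivial := by
  intro h
  have : (Multiplicative.ofAdd 0 : Multiplicative (ZMod 4)) = Multiplicative.ofAdd 1 := h.1 rfl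
  exact absurd (Multiplicative.ofAdd.injective this) (by decide)

theorem IndependentSubgroups.index_inf {K : Type u} [Group K] {ι : Type v} {M : ι → Subgroup K}
    (h : IndependentSubgroups M) {i j : ι} (hij : i ≠ j) :
    (M i ⊓ M j).index = (M i).index * (M j).index := by
  classical
  simpa only [Finset.prod_pair hij, Finset.iInf_insert, Finset.iInf_singleton] using h {i, j}

/-- The index equality forces `(r, s)` to be onto `ℤ/4 × ℤ/4`; a preimage of (generator, identity)
separates the squares. -/
theorem exists_sq_ne_sq_of_index_inf {K : Type u} [Group K] {r s : K →* Multiplicative (ZMod 4)}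
    (hr : Function.Surjective r) (hs : Function.Surjective s)
    (h : (r.ker ⊓ s.ker).index = r.ker.index * s.ker.index) : ∃ x, r x ^ 2 ≠ s x ^ 2 := by
  rw [← MonoidHom.ker_prod, Subgroup.index_ker, Subgroup.index_ker, Subgroup.index_ker,
    MonoidHom.range_eq_top.2 hr, MonoidHom.range_eq_top.2 hs, Subgroup.card_top,
    ← Nat.card_prod] at h
  have htop := MonoidHom.range_eq_top.1 (Subgroup.eq_top_of_card_eq _ h)
  obtain ⟨x, hx⟩ := htop (Multiplicative.ofAdd 1, 1)
  have h1 : r x = Multiplicative.ofAdd 1 := congrArg Prod.fst hx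
  have h2 : s x = 1 := congrArg Prod.snd hx
  refine ⟨x, ?_⟩
  rw [h1, h2]
  decide

/-! ### Groups with the universal property of the free product -/

/-- Homomorphisms from copies of `C` and elements exhibiting `F` as the free profinite product of
these copies and a free profinite group of countable rank. -/
structure FreeProductData (X : Type v) (C : Type w) [Group C] [TopologicalSpace C] (F : Type u)
    [Group F] [TopologicalSpace F] where
  cyc : X → C →ₜ* F
  gen : ℕ → F
  eq_top_of_isClosed : ∀ T : Subgroup F, IsClosed (T : Set F) → (∀ x c, cyc x c ∈ T) →
    (∀ n, gen n ∈ T) → T = ⊤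
  finite_setOf_cyc_notMem : ∀ U : Subgroup F, IsOpen (U : Set F) → {x | ∃ c, cyc x c ∉ U}.Finite
  finite_setOf_gen_notMem : ∀ U : Subgroup F, IsOpen (U : Set F) → {n | gen n ∉ U}.Finite
  exists_lift : ∀ (H : Type) [Group H] [Finite H] [TopologicalSpace H] [DiscreteTopology H]
    (f : X → C →ₜ* H) (_ : {x | ∃ c, f x c ≠ 1}.Finite) (g : ℕ → H)
    (_ : {n | g n ≠ 1}.Finite),
    ∃ ψ : F →ₜ* H, (∀ x c, ψ (cyc x c) = f x c) ∧ ∀ n, ψ (gen n) = g n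

section Prod

variable {X C A B : Type*} [Group C] [TopologicalSpace C]
  [Group A] [TopologicalSpace A] [IsTopologicalGroup A]
  [Group B] [TopologicalSpace B] [IsTopologicalGroup B]

/-- The free profinite product of a free profinite product and a free profinite group has the
expected universal property. -/
def FreeProductData.prod (i : X → C →ₜ* A) (s : ℕ → B)
    (hi : ∀ T : Subgroup A, IsClosed (T : Set A) → (∀ x c, i x c ∈ T) → T = ⊤)
    (hs : ∀ T : Subgroup B, IsClosed (T : Set B) → (∀ n, s n ∈ T) → T = ⊤)
    (hi' : ∀ U : Subgroup A, IsOpen (U : Set A) → {x | ∃ c, i x c ∉ U}.Finite)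
    (hs' : ∀ U : Subgroup B, IsOpen (U : Set B) → {n | s n ∉ U}.Finite)
    (hli : ∀ (H : Type) [Group H] [Finite H] [TopologicalSpace H] [DiscreteTopology H]
      (f : X → C →ₜ* H) (_ : {x | ∃ c, f x c ≠ 1}.Finite),
      ∃ ψ : A →ₜ* H, ∀ x c, ψ (i x c) = f x c)
    (hls : ∀ (H : Type) [Group H] [Finite H] [TopologicalSpace H] [DiscreteTopology H]
      (g : ℕ → H) (_ : {n | g n ≠ 1}.Finite), ∃ ψ : B →ₜ* H, ∀ n, ψ (s n) = g n) :
    FreeProductData X C (FreeProfiniteProd₂ A B) where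
  cyc x := (FreeProfiniteProd₂.inl A B).comp (i x)
  gen n := FreeProfiniteProd₂.inr A B (s n)
  eq_top_of_isClosed T hT hc hg := by
    have hl := hi (T.comap (FreeProfiniteProd₂.inl A B).toMonoidHom)
      (hT.preimage (FreeProfiniteProd₂.inl A B).continuous_toFun) hc
    have hr := hs (T.comap (FreeProfiniteProd₂.inr A B).toMonoidHom)
      (hT.preimage (FreeProfiniteProd₂.inr A B).continuous_toFun) hg
    exact FreeProfiniteProd₂.eq_top_of_isClosed hT ((Subgroup.eq_top_iff' _).1 hl)
      ((Subgroup.eq_top_iff' _).1 hr)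
  finite_setOf_cyc_notMem U hU := hi' (U.comap (FreeProfiniteProd₂.inl A B).toMonoidHom)
    (hU.preimage (FreeProfiniteProd₂.inl A B).continuous_toFun)
  finite_setOf_gen_notMem U hU := hs' (U.comap (FreeProfiniteProd₂.inr A B).toMonoidHom)
    (hU.preimage (FreeProfiniteProd₂.inr A B).continuous_toFun)
  exists_lift H _ _ _ _ f hf g hg := by
    obtain ⟨a, ha⟩ := hli H f hf
    obtain ⟨b, hb⟩ := hls H g hg
    obtain ⟨ψ, hl, hr⟩ := FreeProfiniteProd₂.exists_lift a b
    exact ⟨ψ, fun x c => (hl _).trans (ha x c), fun n => (hr _).trans (hb n)⟩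

end Prod

/-- The free profinite product of copies of `C` and a free profinite group of countable rank has
the expected universal property. -/
def FreeProductData.freeProfiniteProduct (X : Type u) (C : Type v) [Group C] [TopologicalSpace C]
    [IsTopologicalGroup C] : FreeProductData X C
      (FreeProfiniteProd₂ (FreeProfiniteProduct fun _ : X => C) (FreeProfiniteGroup ℕ)) :=
  FreeProductData.prod (FreeProfiniteProduct.incl fun _ : X => C) FreeProfiniteGroup.of
    (fun _ hT => FreeProfiniteProduct.eq_top_of_isClosed (G := fun _ : X => C) hT)
    (fun _ hT => FreeProfiniteGroup.eq_top_of_isClosed hT)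
    (fun _ hU => FreeProfiniteProduct.finite_setOf_exists_notMem (G := fun _ : X => C) hU)
    (fun _ hU => FreeProfiniteGroup.finite_setOf_notMem hU)
    (fun _ _ _ _ _ => FreeProfiniteProduct.exists_lift (G := fun _ : X => C))
    (fun _ _ _ _ _ => FreeProfiniteGroup.exists_lift)

namespace FreeProductData

variable {X : Type u} {F : Type u} [Group F] [TopologicalSpace F]

section Hom

variable {H : Type w} [Group H] [TopologicalSpace H] [DiscreteTopology H]

theorem finite_setOf_cyc_ne_one (D : FreeProductData X PrimeCyclicProduct F) (ψ : F →ₜ* H) :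
    {x | ∃ c, ψ (D.cyc x c) ≠ 1}.Finite :=
  D.finite_setOf_cyc_notMem ψ.toMonoidHom.ker
    ((isOpen_discrete {1}).preimage ψ.continuous_toFun)

theorem finite_setOf_gen_ne_one (D : FreeProductData X PrimeCyclicProduct F) (ψ : F →ₜ* H) :
    {n | ψ (D.gen n) ≠ 1}.Finite :=
  D.finite_setOf_gen_notMem ψ.toMonoidHom.ker
    ((isOpen_discrete {1}).preimage ψ.continuous_toFun)

theorem hom_ext (D : FreeProductData X PrimeCyclicProduct F) {f g : F →ₜ* H}
    (hc : ∀ x c, f (D.cyc x c) = g (D.cyc x c))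
    (hg : ∀ n, f (D.gen n) = g (D.gen n)) : f = g := by
  have := D.eq_top_of_isClosed (f.toMonoidHom.eqLocus g.toMonoidHom)
    (isClosed_eq f.continuous_toFun g.continuous_toFun) hc hg
  exact ContinuousMonoidHom.ext ((Subgroup.eq_top_iff' _).1 this)

end Hom

/-- The images of the generators of the factors of `F`. -/
def generators (D : FreeProductData X PrimeCyclicProduct F) : Set F :=
  Set.range (fun x : X => D.cyc x PrimeCyclicProduct.generator) ∪ Set.range D.gen

theorem generatesTopologically_generators [IsTopologicalGroup F]
    (D : FreeProductData X PrimeCyclicProduct F) :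
    GeneratesTopologically F D.generators := by
  refine D.eq_top_of_isClosed _ (Subgroup.isClosed_topologicalClosure _) (fun x c => ?_) fun n => ?_
  · have h : (Subgroup.closure {PrimeCyclicProduct.generator}).topologicalClosure ≤
        (Subgroup.closure D.generators).topologicalClosure.comap (D.cyc x).toMonoidHom := by
      refine Subgroup.topologicalClosure_minimal _ ((Subgroup.closure_le _).2 ?_)
        ((Subgroup.isClosed_topologicalClosure _).preimage (D.cyc x).continuous_toFun)
      rintro _ rfl
      exact Subgroup.le_topologicalClosure _ (Subgroup.subset_closure (Or.inl ⟨x, rfl⟩))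
    rw [PrimeCyclicProduct.closure_generator] at h
    exact h (Subgroup.mem_top c)
  · exact Subgroup.le_topologicalClosure _ (Subgroup.subset_closure (Or.inr ⟨n, rfl⟩))

theorem convergesToOne_generators (D : FreeProductData X PrimeCyclicProduct F) :
    ConvergesToOne F D.generators := by
  intro U hU
  refine (((D.finite_setOf_cyc_notMem U hU).image
    fun x => D.cyc x PrimeCyclicProduct.generator).union
      ((D.finite_setOf_gen_notMem U hU).image D.gen)).subset ?_
  rintro _ ⟨⟨x, rfl⟩ | ⟨n, rfl⟩, h⟩
  · exact Or.inl ⟨x, ⟨_, h⟩, rfl⟩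
  · exact Or.inr ⟨n, h, rfl⟩

theorem mk_generators_le [Infinite X]
    (D : FreeProductData X PrimeCyclicProduct F) : Cardinal.mk D.generators ≤ Cardinal.mk X := by
  refine (Cardinal.mk_union_le _ _).trans ?_
  refine Cardinal.add_le_of_le (Cardinal.aleph0_le_mk X) Cardinal.mk_range_le ?_
  exact (Set.countable_range _).le_aleph0.trans (Cardinal.aleph0_le_mk X)

/-! ### Proper solutions -/

/-- The free generators provide surjectivity and the copies of `C` provide the number of solutions;
the two modifications of `β ∘ φ` do not interfere. -/
theorem mk_le_mk_properSolutions (D : FreeProductData X PrimeCyclicProduct F) [Infinite X]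
    (E : FiniteEmbeddingProblem F)
    (hs : E.IsSplit) (hn : E.IsNontrivial) : Cardinal.mk X ≤ Cardinal.mk E.properSolutions := by
  classical
  obtain ⟨β, hβ⟩ := hs
  let K : Subgroup E.H := E.α.toMonoidHom.ker
  have hK : Nat.card K ≠ 1 := by
    intro h
    refine hn ⟨(MonoidHom.ker_eq_bot_iff E.α.toMonoidHom).1 ?_, E.α_surjective⟩
    exact Subgroup.card_eq_one.1 h
  obtain ⟨p, hp, hpK⟩ := Nat.exists_prime_and_dvd hK
  have : Fact p.Prime := ⟨hp⟩
  obtain ⟨k, hk⟩ := exists_prime_orderOf_dvd_card' (G := K) p hpK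
  have hk1 : (k : E.H) ≠ 1 := by
    intro h
    rw [← Subgroup.orderOf_coe, h, orderOf_one] at hk
    exact hp.one_lt.ne hk
  obtain ⟨f, hfk, c, hc⟩ := PrimeCyclicProduct.exists_hom (k := (k : E.H)) ⟨p, hp⟩
    ((Subgroup.orderOf_coe k).trans hk)
  have hfα (c) : E.α (f c) = 1 := (Subgroup.zpowers_le.2 k.2 : _ ≤ K) (hfk c)
  let βc : E.G →ₜ* E.H := ⟨β, continuous_of_discreteTopology⟩
  let ρ : F →ₜ* E.H := βc.comp E.φ
  have hρ (y) : E.α (ρ y) = E.φ y := hβ _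
  -- Infinitely many free generators die under `ρ`, leaving room to place all elements of `K`.
  have hgen : {n | ρ (D.gen n) = 1}.Infinite := (D.finite_setOf_gen_ne_one ρ).infinite_compl.mono
    fun n hn => not_not.1 hn
  obtain ⟨e⟩ : Nonempty (K ↪ {n | ρ (D.gen n) = 1}) :=
    ⟨(Finite.equivFin K).toEmbedding.trans
      (Fin.valEmbedding.trans (Set.Infinite.natEmbedding _ hgen))⟩
  have he : Function.Injective fun k => (e k : ℕ) := Subtype.val_injective.comp e.injective
  let g : ℕ → E.H := Function.extend (fun k => (e k : ℕ)) Subtype.val fun n => ρ (D.gen n)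
  have hge (k : K) : g (e k) = k := he.extend_apply _ _ k
  have hgα (n) : E.α (g n) = E.φ (D.gen n) := by
    by_cases h : ∃ k, (e k : ℕ) = n
    · obtain ⟨k, rfl⟩ := h
      have h1 : ρ (D.gen (e k)) = 1 := (e k).2
      rw [hge, ← hρ, h1, map_one]
      exact k.2
    · simp only [g, Function.extend_apply' _ _ _ h, hρ]
  have hgfin : {n | g n ≠ 1}.Finite := by
    refine ((D.finite_setOf_gen_ne_one ρ).union (Set.finite_range fun k => (e k : ℕ))).subset
      fun n hn => ?_
    by_cases h : ∃ k, (e k : ℕ) = n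
    · exact Or.inr h
    · left
      simpa only [g, Set.mem_ofPred_eq, Function.extend_apply' _ _ _ h] using hn
  -- `ψ x` takes the values `g` on the free generators and agrees with `ρ` on every copy of `C`
  -- except the one at `x`, where it is `f`.
  have hex (x : X)  := D.exists_lift E.H (Function.update (fun y => ρ.comp (D.cyc y)) x f) (by
    refine ((D.finite_setOf_cyc_ne_one ρ).union (Set.finite_singleton x)).subset ?_
    rintro y ⟨c, hc⟩
    by_cases hxy : y = x
    · exact Or.inr hxy
    · rw [Function.update_of_ne hxy] at hc
      exact Or.inl ⟨c, hc⟩) g hgfin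
  choose ψ hψc hψg using hex
  let Y : Set X := {x | ∃ c, ρ (D.cyc x c) ≠ 1}ᶜ
  have hY : ∀ x ∈ Y, ∀ c, ρ (D.cyc x c) = 1 := by
    intro x hx c
    by_contra h
    exact hx ⟨c, h⟩
  have hα : ∀ x ∈ Y, ∀ y, E.α (ψ x y) = E.φ y := by
    intro x hx
    have : E.α.comp (ψ x) = E.φ := by
      refine D.hom_ext (fun y c => ?_) fun n => ?_
      · change E.α (ψ x (D.cyc y c)) = _
        rw [hψc]
        by_cases hxy : y = x
        · subst hxy
          rw [Function.update_self, hfα, ← hρ, hY y hx, map_one]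
        · rw [Function.update_of_ne hxy]
          exact hρ _
      · change E.α (ψ x (D.gen n)) = _
        rw [hψg, hgα]
    exact fun y => DFunLike.congr_fun this y
  have hsurj : ∀ x ∈ Y, Function.Surjective (ψ x) := by
    intro x hx h
    obtain ⟨y, hy⟩ := E.φ_surjective (E.α h)
    have hk : (ψ x y)⁻¹ * h ∈ K := by
      change E.α _ = 1
      rw [map_mul, map_inv, hα x hx, hy, inv_mul_cancel]
    refine ⟨y * D.gen (e ⟨_, hk⟩), ?_⟩
    rw [map_mul, hψg, hge, mul_inv_cancel_left]
  have hinj : Function.Injective fun x : Y =>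
      (⟨ψ x, hα x x.2, hsurj x x.2⟩ : E.properSolutions) := by
    intro x y hxy
    by_contra hne
    -- On the copy at `x`, the element `c` goes to `k ≠ 1` under `ψ x` but to `1` under `ψ y`.
    have h1 : ψ x (D.cyc (x : X) c) = ψ y (D.cyc (x : X) c) :=
      DFunLike.congr_fun (congrArg Subtype.val hxy) _
    rw [hψc, hψc, Function.update_self, Function.update_of_ne (fun h => hne (Subtype.ext h)),
      hc] at h1
    exact hk1 (h1.trans (hY x x.2 c))
  calc Cardinal.mk X = Cardinal.mk Y := by
        refine (Cardinal.mk_compl_of_infinite _ ?_).symm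
        exact (Cardinal.lt_aleph0_iff_set_finite.2 (D.finite_setOf_cyc_ne_one ρ)).trans_le
          (Cardinal.aleph0_le_mk X)
    _ ≤ _ := Cardinal.mk_le_of_injective hinj

/-- The problem for `ℤ/4` already forces `|X|` homomorphisms, more than a finite set `S` allows and
at most `|S|` for an infinite one. -/
theorem mk_le_of_generates [IsTopologicalGroup F] (D : FreeProductData X PrimeCyclicProduct F)
    [Infinite X] {S : Set F}
    (hS : GeneratesTopologically F S) (hconv : ConvergesToOne F S) :
    S.Infinite ∧ Cardinal.mk X ≤ Cardinal.mk S := by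
  have h := (D.mk_le_mk_properSolutions (zmodFourProblem F)
    (zmodFourProblem_isSplit _) (zmodFourProblem_isNontrivial _)).trans (Cardinal.mk_set_le _)
  have hinf : S.Infinite := by
    intro hfin
    have := hS.finite_hom (H := (zmodFourProblem F).H) hfin
    exact (Cardinal.aleph0_le_mk X).not_gt (h.trans_lt Cardinal.mk_lt_aleph0)
  exact ⟨hinf, h.trans (hS.mk_hom_le hconv hinf)⟩

theorem profiniteRank_eq [IsTopologicalGroup F] [Infinite X]
    (D : FreeProductData X PrimeCyclicProduct F) : profiniteRank F = Cardinal.mk X := by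
  have hmem : Cardinal.mk D.generators ∈ {c | ∃ S : Set F, GeneratesTopologically F S ∧
      ConvergesToOne F S ∧ Cardinal.mk S = c} :=
    ⟨D.generators, D.generatesTopologically_generators, D.convergesToOne_generators, rfl⟩
  refine le_antisymm ((csInf_le' hmem).trans D.mk_generators_le) (le_csInf ⟨_, hmem⟩ ?_)
  rintro _ ⟨S, hS, hconv, rfl⟩
  exact (D.mk_le_of_generates hS hconv).2

theorem hasExactlyProperSolutions [IsTopologicalGroup F] [Infinite X]
    (D : FreeProductData X PrimeCyclicProduct F) :
    HasExactlyProperSolutions F (Cardinal.mk X) := by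
  intro E hs hn
  refine le_antisymm ?_ (D.mk_le_mk_properSolutions E hs hn)
  exact (Cardinal.mk_set_le _).trans ((D.generatesTopologically_generators.mk_hom_le
    D.convergesToOne_generators (D.mk_le_of_generates D.generatesTopologically_generators
      D.convergesToOne_generators).1).trans D.mk_generators_le)

/-! ### Countability of independent solutions for `ℤ/4` -/

/-- The squared homomorphisms are trivial on every copy of `C`, so they can differ only on the free
generators. -/
theorem sq_eq_sq (D : FreeProductData X PrimeCyclicProduct F)
    {f g : F →ₜ* Multiplicative (ZMod 4)}
    (h : ∀ n, f (D.gen n) = g (D.gen n)) (y : F) : f y ^ 2 = g y ^ 2 := by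
  have hcyc (f : F →ₜ* Multiplicative (ZMod 4)) (x : X) (c) :
      f (D.cyc x c) ^ 2 = 1 := by
    obtain ⟨d, hd⟩ := PrimeCyclicProduct.exists_sq_eq_pow_four c
    rw [← map_pow, ← map_pow, hd, map_pow, map_pow]
    generalize f (D.cyc x d) = z
    revert z
    decide
  let sq (f : F →ₜ* Multiplicative (ZMod 4)) :
      F →ₜ* Multiplicative (ZMod 4) :=
    ContinuousMonoidHom.comp ⟨powMonoidHom 2, continuous_of_discreteTopology⟩ f
  have : sq f = sq g := by
    refine D.hom_ext (fun x c => ?_) fun n => ?_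
    · exact (hcyc f x c).trans (hcyc g x c).symm
    · exact congrArg (· ^ 2) (h n)
  exact DFunLike.congr_fun this y

theorem countable_of_independent (D : FreeProductData X PrimeCyclicProduct F)
    {Ψ : Set (F →ₜ* Multiplicative (ZMod 4))} (hΨ : Ψ ⊆ (zmodFourProblem F).properSolutions)
    (hind : (zmodFourProblem F).IndependentSolutions Ψ) : Ψ.Countable := by
  classical
  have hfin (ψ : F →ₜ* Multiplicative (ZMod 4)) :
      (Function.support fun n => Multiplicative.toAdd (ψ (D.gen n))).Finite :=
    D.finite_setOf_gen_ne_one ψ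
  -- The target is the countable type of finitely supported functions from `ℕ` to `ZMod 4`.
  have hinj : Function.Injective fun ψ : Ψ => Finsupp.ofSupportFinite _ (hfin ψ.1) := by
    intro f g hfg
    by_contra hne
    have hgen (n) : f.1 (D.gen n) = g.1 (D.gen n) := DFunLike.congr_fun hfg n
    let K : Subgroup F := (zmodFourProblem F).φ.toMonoidHom.ker
    -- Since `φ` maps to the trivial group, `K` is all of `F`, and restricting to it keeps
    -- surjectivity.
    have hsurj (ψ : Ψ) : Function.Surjective (ψ.1.toMonoidHom.comp K.subtype) := by
      intro z
      obtain ⟨y, hy⟩ := (hΨ ψ.2).2 z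
      exact ⟨⟨y, rfl⟩, hy⟩
    obtain ⟨x, hx⟩ := exists_sq_ne_sq_of_index_inf (hsurj f) (hsurj g) (hind.index_inf hne)
    exact hx (D.sq_eq_sq hgen x)
  exact Set.countable_coe_iff.1 hinj.countable

theorem quasiFree_and_not_semiFree [IsTopologicalGroup F] [CompactSpace F]
    [TotallyDisconnectedSpace F] (D : FreeProductData X PrimeCyclicProduct F) (m : Cardinal.{u})
    (hX : Cardinal.mk X = m)
    (hm : Cardinal.aleph0 ≤ m) :
    (IsQuasiFree F ∧ profiniteRank F = m ∧
        HasExactlyProperSolutions F m) ∧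
      ((zmodFourProblem F).IsSplit ∧
        ∀ Ψ ⊆ (zmodFourProblem F).properSolutions,
          (zmodFourProblem F).IndependentSolutions Ψ → Ψ.Countable) ∧
      (Cardinal.aleph0 < m → IsQuasiFree F ∧ ¬ IsSemiFree F) := by
  subst hX
  have : Infinite X := Cardinal.infinite_iff.2 hm
  have hrank := D.profiniteRank_eq
  have hsol := D.hasExactlyProperSolutions
  have hqf : IsQuasiFree F := ⟨hrank ▸ hm, _, hm, hsol⟩
  have hsplit := zmodFourProblem_isSplit F
  refine ⟨⟨hqf, hrank, hsol⟩, ⟨hsplit, fun Ψ h1 h2 =>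
    D.countable_of_independent h1 h2⟩, fun hlt => ⟨hqf, fun hsf => ?_⟩⟩
  obtain ⟨Ψ, h1, h2, h3⟩ := hsf.2 _ hsplit (zmodFourProblem_isNontrivial _)
  have := (D.countable_of_independent h1 h2).le_aleph0
  exact hlt.not_ge ((h3.trans hrank).symm.le.trans this)

end FreeProductData

theorem mainTheorem7 (X : Type u) (m : Cardinal.{u}) (hX : Cardinal.mk X = m)
    (hm : Cardinal.aleph0 ≤ m) :
    (IsQuasiFree (ExampleGroup X) ∧ profiniteRank (ExampleGroup X) = m ∧
        HasExactlyProperSolutions (ExampleGroup X) m) ∧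
      ((zmodFourProblem (ExampleGroup X)).IsSplit ∧
        ∀ Ψ ⊆ (zmodFourProblem (ExampleGroup X)).properSolutions,
          (zmodFourProblem (ExampleGroup X)).IndependentSolutions Ψ → Ψ.Countable) ∧
      (Cardinal.aleph0 < m → IsQuasiFree (ExampleGroup X) ∧ ¬ IsSemiFree (ExampleGroup X)) := by
  exact (FreeProductData.freeProfiniteProduct X PrimeCyclicProduct).quasiFree_and_not_semiFree
    m hX hm
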